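/- Setting. Let $(Y_j)_{j\ge 0}$ be i.i.d. real random variables (transmission delays) with $\Pr(Y_j\in[B_L,B_U])=1$ and $B_L>0$. Let $g:[0,\infty)\to[0,\infty)$ be continuous and nondecreasing, let $Q>0$ be the query time, and let $M\ge 0$ be the largest admissible waiting period, with $M\ge Q-B_L$. A (causal, possibly randomized) update policy chooses waiting periods $Z_j\in[0,M]$, $j\ge 0$, where $Z_j$ is a measurable function of the delays $Y_0,\dots,Y_j$ observed so far and of a private random variable that is independent of all the delays. Update $0$ is delivered at time $D_0=0$, so it was requested at $R_0=-Y_0$, and for $j\ge 0$ update $j+1$ is requested at $R_{j+1}=D_j+Z_j$ and delivered at $D_{j+1}=R_{j+1}+Y_{j+1}$. The age at the query is $\Delta(Q)=Q-\sup\{R_j : D_j\le Q\}$ and the expected age penalty of the policy is $E[g(\Delta(Q))]$. The optimal expected age penalty for a delay process is the infimum of the expected age penalty over all such policies when that process supplies the delays. For an integer $N\ge 1$, the upper and the lower quantized delay processes are $$Y_j^{upp}=\frac QN\left\lceil \frac{Y_j}{Q/N}\right\rceil ,\qquad Y_j^{low}=\frac QN\left\lfloor \frac{Y_j}{Q/N}\right\rfloor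 .$$ Proposition. For every such delay process and every $N\ge 1$: (i) there is an update policy for the delay process $(Y_j)$ whose expected age penalty is at most the optimal expected age penalty for the upper quantized process $(Y_j^{upp})$; (ii) the optimal expected age penalty for the lower quantized process $(Y_j^{low})$ is at most the optimal expected age penalty for $(Y_j)$. -/

import Mathlib

open MeasureTheory ProbabilityTheory
open scoped NNReal ENNReal

namespace PullOrWait

/-- A causal, possibly randomized, update policy with waiting periods in `[0, M]`.
`Seed` carries the private randomization of the policy, which is drawn independently of the delays.
After the delivery of update `j` the policy picks the waiting period `Z_j` as a function of its
private randomization and of the delays `Y_0, …, Y_j` observed so far; the earlier waiting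
periods are themselves functions of these data. -/
structure Policy (M : ℝ) where
  /-- The sample space of the private randomization. -/
  Seed : Type
  /-- Its σ-algebra. -/
  instMeasurableSpace : MeasurableSpace Seed
  /-- The law of the private randomization. -/
  law : Measure Seed
  /-- It is a probability measure. -/
  instIsProbabilityMeasure : IsProbabilityMeasure law
  /-- `wait j s (Y_0, …, Y_j)` is the waiting period `Z_j`. -/
  wait : (j : ℕ) → Seed → (Fin (j + 1) → ℝ) → ℝ
  measurable_wait : ∀ j, Measurable (fun p : Seed × (Fin (j + 1) → ℝ) => wait j p.1 p.2)
  wait_mem : ∀ j s y, wait j s y ∈ Set.Icc 0 M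

attribute [instance] Policy.instMeasurableSpace Policy.instIsProbabilityMeasure

/-- The waiting periods `Z_0, Z_1, …` chosen by a policy along the delay sequence `y`, when its
private randomization takes the value `s`. -/
def Policy.waits {M : ℝ} (π : Policy M) (s : π.Seed) (y : ℕ → ℝ) (j : ℕ) : ℝ :=
  π.wait j s (fun i : Fin (j + 1) => y i)

/-- Request times for delays `y` and waiting periods `z`. Update `0` is the one that has just been
delivered at time `0`, so it was requested at `-Y_0`; then `R_{j+1} = R_j + Y_j + Z_j`. -/
def requestTime (y z : ℕ → ℝ) : ℕ → ℝ
  | 0 => -y 0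
  | j + 1 => requestTime y z j + y j + z j

/-- Delivery times `D_j = R_j + Y_j`. -/
def deliveryTime (y z : ℕ → ℝ) (j : ℕ) : ℝ :=
  requestTime y z j + y j

/-- The generation time `U(t)` of the freshest update delivered by time `t`. -/
noncomputable def freshest (y z : ℕ → ℝ) (t : ℝ) : ℝ :=
  sSup {r : ℝ | ∃ j : ℕ, deliveryTime y z j ≤ t ∧ requestTime y z j = r}

/-- The age of information `Δ(t) = t - U(t)`. -/
noncomputable def age (y z : ℕ → ℝ) (t : ℝ) : ℝ :=
  t - freshest y z t

/-- The expected age penalty `E[g(Δ(Q))]` at the query time `Q` of the policy `π`, when the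
transmission delays are the random variables `Y j` on the probability space `(Ω, P)`. -/
noncomputable def expectedPenalty {Ω : Type*} [MeasurableSpace Ω] (P : Measure Ω)
    (Y : ℕ → Ω → ℝ) (g : ℝ≥0 → ℝ≥0) (Q : ℝ) {M : ℝ} (π : Policy M) : ℝ≥0∞ :=
  ∫⁻ p : Ω × π.Seed,
    (g (age (fun j => Y j p.1) (π.waits p.2 (fun j => Y j p.1)) Q).toNNReal : ℝ≥0∞)
      ∂(P.prod π.law)

/-- The optimal expected age penalty of the single query problem over all policies with waiting
periods in `[0, M]`. -/
noncomputable def optimalPenalty {Ω : Type*} [MeasurableSpace Ω] (P : Measure Ω)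
    (Y : ℕ → Ω → ℝ) (g : ℝ≥0 → ℝ≥0) (Q M : ℝ) : ℝ≥0∞ :=
  ⨅ π : Policy M, expectedPenalty P Y g Q π

/-- The upper quantization with step `q` of a delay process. -/
noncomputable def upperQuantized {Ω : Type*} (q : ℝ) (Y : ℕ → Ω → ℝ) : ℕ → Ω → ℝ :=
  fun j ω => q * (⌈Y j ω / q⌉ : ℝ)

/-- The lower quantization with step `q` of a delay process. -/
noncomputable def lowerQuantized {Ω : Type*} (q : ℝ) (Y : ℕ → Ω → ℝ) : ℕ → Ω → ℝ :=
  fun j ω => q * (⌊Y j ω / q⌋ : ℝ)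

end PullOrWait

/-! ### Pathwise comparison of ages -/

namespace PullOrWait

/-! A policy facing short delays can imitate one facing longer delays: after each delivery it waits
until the pretended, later delivery, then for the imitated waiting period. Requests that matter
coincide and deliveries come no later, so the age does not grow (`age_le_age_of_dominated`, averaged
in `expectedPenalty_simulate_le`).

For (i), the pretended delays are the rounded-up ones. A single policy must reach the infimum, so an
optimal policy to imitate is supplied by compactness (`exists_expectedPenalty_le_optimalPenalty`).

For (ii), the rounded-down delay does not determine the true one, so a delay is drawn from the
conditional law given the quantized value. Because the delays are i.i.d., the drawn sequence has the
law of `Y` (`map_resample`), and it dominates the lower quantization (`ae_resample_mem_fibre`). -/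

@[simp] lemma deliveryTime_zero (y z : ℕ → ℝ) : deliveryTime y z 0 = 0 := by
  simp [deliveryTime, requestTime]

lemma requestTime_succ (y z : ℕ → ℝ) (j : ℕ) :
    requestTime y z (j + 1) = deliveryTime y z j + z j := rfl

lemma deliveryTime_succ (y z : ℕ → ℝ) (j : ℕ) :
    deliveryTime y z (j + 1) = deliveryTime y z j + z j + y (j + 1) := rfl

lemma monotone_deliveryTime {y z : ℕ → ℝ} (hy : ∀ j, 0 ≤ y j) (hz : ∀ j, 0 ≤ z j) :
    Monotone (deliveryTime y z) :=
  monotone_nat_of_le_succ fun j => by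
    rw [deliveryTime_succ]
    linarith [hy (j + 1), hz j]

lemma deliveryTime_nonneg {y z : ℕ → ℝ} (hy : ∀ j, 0 ≤ y j) (hz : ∀ j, 0 ≤ z j) (j : ℕ) :
    0 ≤ deliveryTime y z j :=
  (deliveryTime_zero y z).symm.le.trans (monotone_deliveryTime hy hz j.zero_le)

lemma mul_le_deliveryTime {y z : ℕ → ℝ} {δ : ℝ} (hy : ∀ j, δ ≤ y j) (hz : ∀ j, 0 ≤ z j) (j : ℕ) :
    j * δ ≤ deliveryTime y z j := by
  induction j with
  | zero => simp
  | succ j ih =>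
    rw [deliveryTime_succ]
    push_cast
    linarith [hy (j + 1), hz j]

lemma bddAbove_delivered {y : ℕ → ℝ} (hy : ∀ j, 0 ≤ y j) (z : ℕ → ℝ) (t : ℝ) :
    BddAbove {r : ℝ | ∃ j : ℕ, deliveryTime y z j ≤ t ∧ requestTime y z j = r} := by
  refine ⟨t, ?_⟩
  rintro r ⟨j, hj, rfl⟩
  have := hy j
  unfold deliveryTime at hj
  linarith

lemma freshest_le {y z : ℕ → ℝ} {t b : ℝ} (ht : 0 ≤ t)
    (h : ∀ j, deliveryTime y z j ≤ t → requestTime y z j ≤ b) : freshest y z t ≤ b := by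
  refine csSup_le ⟨_, 0, by simpa using ht, rfl⟩ ?_
  rintro r ⟨j, hj, rfl⟩
  exact h j hj

lemma requestTime_le_freshest {y z : ℕ → ℝ} {t : ℝ} (hy : ∀ j, 0 ≤ y j) {j : ℕ}
    (hj : deliveryTime y z j ≤ t) : requestTime y z j ≤ freshest y z t :=
  le_csSup (bddAbove_delivered hy z t) ⟨j, hj, rfl⟩

/-- If the delays `y` are dominated by `y'`, then waiting out the differences `y' - y` on top of
the waiting periods `z'` loses nothing, even when the total waiting period is capped at `M`. -/
lemma age_le_age_of_dominated {y y' z z' : ℕ → ℝ} {B Q M : ℝ} (hQ : 0 ≤ Q) (hM : Q - B ≤ M)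
    (hy : ∀ j, 0 ≤ y j) (hyy' : ∀ j, y j ≤ y' j) (hB : ∀ j, B ≤ y' j)
    (hz' : ∀ j, z' j ∈ Set.Icc 0 M)
    (hz : ∀ j, z j = max 0 (min M (z' j + if j = 0 then 0 else y' j - y j))) :
    age y z Q ≤ age y' z' Q := by
  have hy' : ∀ j, 0 ≤ y' j := fun j => (hy j).trans (hyy' j)
  have hz0 : ∀ j, 0 ≤ z j := fun j => (hz j).symm ▸ le_max_left _ _
  have hmono := monotone_deliveryTime hy' fun j => (hz' j).1
  -- Only updates delivered by `Q` matter; for later ones the cap `M` may bind and the requests may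
  -- differ.
  have key : ∀ j, deliveryTime y' z' (j + 1) ≤ Q →
      requestTime y z (j + 1) = requestTime y' z' (j + 1) := by
    intro j
    induction j with
    | zero =>
      intro _
      rw [requestTime_succ, requestTime_succ, hz]
      simp [(hz' 0).1, (hz' 0).2]
    | succ j ih =>
      intro h
      have hj := ih ((hmono (Nat.le_succ _)).trans h)
      have hD := deliveryTime_nonneg hy hz0 (j + 1)
      have hB' := hB (j + 2)
      rw [requestTime_succ, requestTime_succ, hz, if_neg j.succ_ne_zero]
      have hR : deliveryTime y' z' (j + 1) = requestTime y' z' (j + 1) + y' (j + 1) := rfl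
      have hR' : deliveryTime y z (j + 1) = requestTime y z (j + 1) + y (j + 1) := rfl
      rw [deliveryTime_succ] at h
      have h1 : z' (j + 1) + (y' (j + 1) - y (j + 1)) ≤ M := by linarith
      rw [min_eq_right h1, max_eq_right (by linarith [hyy' (j + 1), (hz' (j + 1)).1])]
      linarith
  refine sub_le_sub_left (freshest_le hQ fun j hj => ?_) Q
  cases j with
  | zero =>
    refine le_trans ?_ (requestTime_le_freshest (j := 0) hy (by simpa using hQ))
    simpa [requestTime] using hyy' 0
  | succ j =>
    rw [← key j hj]
    refine requestTime_le_freshest hy (le_trans ?_ hj)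
    simp only [deliveryTime]
    rw [key j hj]
    linarith [hyy' (j + 1)]

/-! ### Measurability and lower semicontinuity of the age -/

/-- The default `requestTime y z 0` adds nothing, as update `0` is delivered at time `0 ≤ t`. This
form is a countable supremum of measurable functions. -/
lemma freshest_eq_iSup (y z : ℕ → ℝ) {t : ℝ} (ht : 0 ≤ t) :
    freshest y z t =
      ⨆ j, if deliveryTime y z j ≤ t then requestTime y z j else requestTime y z 0 := by
  rw [freshest, iSup]
  congr 1
  ext r
  constructor
  · rintro ⟨j, hj, rfl⟩
    exact ⟨j, if_pos hj⟩
  · rintro ⟨j, rfl⟩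
    by_cases hj : deliveryTime y z j ≤ t
    · exact ⟨j, hj, (if_pos hj).symm⟩
    · exact ⟨0, by simpa using ht, (if_neg hj).symm⟩

section Measurability

variable {α : Type*} [MeasurableSpace α] {y z : α → ℕ → ℝ}

lemma measurable_requestTime (hy : ∀ j, Measurable fun a => y a j)
    (hz : ∀ j, Measurable fun a => z a j) (j : ℕ) :
    Measurable fun a => requestTime (y a) (z a) j := by
  induction j with
  | zero => exact (hy 0).neg
  | succ j ih => exact (ih.add (hy j)).add (hz j)

lemma measurable_age (hy : ∀ j, Measurable fun a => y a j) (hz : ∀ j, Measurable fun a => z a j)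
    {t : ℝ} (ht : 0 ≤ t) : Measurable fun a => age (y a) (z a) t := by
  simp only [age, freshest_eq_iSup _ _ ht]
  refine measurable_const.sub (Measurable.iSup fun j => ?_)
  exact Measurable.ite
    (measurableSet_le ((measurable_requestTime hy hz j).add (hy j)) measurable_const)
    (measurable_requestTime hy hz j) (measurable_requestTime hy hz 0)

end Measurability

section Semicontinuity

variable {X : Type*} [TopologicalSpace X] {z : X → ℕ → ℝ}

lemma continuous_requestTime (y : ℕ → ℝ) (hz : ∀ j, Continuous fun x => z x j) (j : ℕ) :
    Continuous fun x => requestTime y (z x) j := by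
  induction j with
  | zero => exact continuous_const
  | succ j ih => exact (ih.add continuous_const).add (hz j)

/-- A small change of the waiting periods can lose an update delivered exactly at `Q`, but cannot
gain one delivered strictly later; so the age can only jump up nearby. -/
lemma lowerSemicontinuous_age {y : ℕ → ℝ} {δ Q : ℝ} (hδ : 0 < δ) (hQ : 0 ≤ Q)
    (hy : ∀ j, δ ≤ y j) (hz : ∀ j, Continuous fun x => z x j) (hz0 : ∀ x j, 0 ≤ z x j) :
    LowerSemicontinuous fun x => age y (z x) Q := by
  intro x a ha
  obtain ⟨b, hab, hb⟩ := exists_between ha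
  -- Delays of at least `δ` leave only the updates below `n` a chance of delivery by `Q`.
  obtain ⟨n, hn⟩ := exists_nat_gt (Q / δ)
  have h : ∀ j ∈ Finset.range n, ∀ᶠ x' in nhds x,
      deliveryTime y (z x') j ≤ Q → requestTime y (z x') j ≤ Q - b := by
    intro j _
    have hc := continuous_requestTime y hz j
    by_cases hj : deliveryTime y (z x) j ≤ Q
    · have : requestTime y (z x) j < Q - b := by
        have := requestTime_le_freshest (fun i => hδ.le.trans (hy i)) hj
        simp only [age] at hb
        linarith
      filter_upwards [hc.continuousAt.eventually_lt_const this] with x' hx' _ using hx'.le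
    · have hc' : Continuous fun x => deliveryTime y (z x) j := hc.add continuous_const
      filter_upwards [hc'.continuousAt.eventually_const_lt (not_le.1 hj)] with x' hx' hx''
      exact absurd hx'' (not_le.2 hx')
  filter_upwards [(Filter.eventually_all_finset _).2 h] with x' hx'
  have : freshest y (z x') Q ≤ Q - b := by
    refine freshest_le hQ fun j hj => hx' j (Finset.mem_range.2 ?_) hj
    have h1 := (mul_le_deliveryTime hy (hz0 x') j).trans hj
    exact_mod_cast ((le_div_iff₀ hδ).2 h1).trans_lt hn
  simp only [age]
  linarith

end Semicontinuity

/-- The penalty for the age `a`, as a function on the reals. -/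
noncomputable def penalty (g : ℝ≥0 → ℝ≥0) (a : ℝ) : ℝ≥0∞ := (g a.toNNReal : ℝ≥0∞)

lemma monotone_penalty {g : ℝ≥0 → ℝ≥0} (hg : Monotone g) : Monotone (penalty g) :=
  fun _ _ h => ENNReal.coe_le_coe.2 (hg (Real.toNNReal_le_toNNReal h))

lemma continuous_penalty {g : ℝ≥0 → ℝ≥0} (hg : Continuous g) : Continuous (penalty g) :=
  ENNReal.continuous_coe.comp (hg.comp continuous_real_toNNReal)

/-- The seed in `β` is independent of the simulated data `T`, so only the law of `T` matters. -/
lemma lintegral_prod_prod_eq_lintegral_map {α β γ δ : Type*} [MeasurableSpace α]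
    [MeasurableSpace β] [MeasurableSpace γ] [MeasurableSpace δ] (μ : Measure α) (σ : Measure β)
    (ρ : Measure γ) [SFinite μ] [SFinite σ] [SFinite ρ] {T : α × γ → δ} (hT : Measurable T)
    {F : δ × β → ℝ≥0∞} (hF : Measurable F) :
    ∫⁻ q, F (T (q.1, q.2.2), q.2.1) ∂μ.prod (σ.prod ρ) =
      ∫⁻ s, ∫⁻ y, F (y, s) ∂(μ.prod ρ).map T ∂σ := by
  have hmid : Measurable fun q : α × β × γ => F (T (q.1, q.2.2), q.2.1) :=
    hF.comp ((hT.comp (measurable_fst.prodMk measurable_snd.snd)).prodMk measurable_snd.fst)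
  rw [lintegral_prod _ hmid.aemeasurable]
  have h : ∀ a, ∫⁻ r : β × γ, F (T (a, r.2), r.1) ∂σ.prod ρ =
      ∫⁻ s, ∫⁻ w, F (T (a, w), s) ∂ρ ∂σ := fun a =>
    lintegral_prod _ (hmid.comp measurable_prodMk_left).aemeasurable
  simp only [h]
  rw [lintegral_lintegral_swap]
  · refine lintegral_congr fun s => ?_
    have hs : Measurable fun y => F (y, s) := hF.comp measurable_prodMk_right
    rw [lintegral_map hs hT]
    exact (lintegral_prod (fun p => F (T p, s)) (hs.comp hT).aemeasurable).symm
  · refine Measurable.aemeasurable ?_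
    have hr : Measurable fun r : (α × β) × γ => F (T (r.1.1, r.2), r.1.2) :=
      hF.comp ((hT.comp (measurable_fst.fst.prodMk measurable_snd)).prodMk measurable_fst.snd)
    exact hr.lintegral_prod_right'

/-! ### Imitating a policy on dominating delays -/

section Simulation

variable {M : ℝ}

lemma Policy.measurable_waits {α : Type*} [MeasurableSpace α] (π : Policy M) {s : α → π.Seed}
    {y : α → ℕ → ℝ} (hs : Measurable s) (hy : ∀ j, Measurable fun a => y a j) (j : ℕ) :
    Measurable fun a => π.waits (s a) (y a) j :=
  (π.measurable_wait j).comp (hs.prodMk (measurable_pi_lambda _ fun i => hy i))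

/-- The policy that runs `π` on the simulated delays `h j w (y j)`, where `w` is additional
private randomization with law `ρ`, and waits in addition until the simulated delivery. -/
noncomputable def Policy.simulate (π : Policy M) (hM : 0 ≤ M) {W : Type} [MeasurableSpace W]
    (ρ : Measure W) [IsProbabilityMeasure ρ] (h : ℕ → W → ℝ → ℝ)
    (hh : ∀ j, Measurable fun p : W × ℝ => h j p.1 p.2) : Policy M where
  Seed := π.Seed × W
  instMeasurableSpace := inferInstance
  law := π.law.prod ρ
  instIsProbabilityMeasure := inferInstance
  -- Nothing is added at `j = 0`, since update `0` is delivered at time `0` in both systems.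
  wait j s y := max 0 (min M (π.wait j s.1 (fun i => h i s.2 (y i)) +
    if j = 0 then 0 else h j s.2 (y (Fin.last j)) - y (Fin.last j)))
  measurable_wait j := by
    have h1 : Measurable fun p : (π.Seed × W) × (Fin (j + 1) → ℝ) =>
        π.wait j p.1.1 (fun i => h i p.1.2 (p.2 i)) := by
      refine (π.measurable_wait j).comp (measurable_fst.fst.prodMk ?_)
      refine measurable_pi_lambda _ fun i => ?_
      exact (hh i).comp (measurable_fst.snd.prodMk ((measurable_pi_apply i).comp measurable_snd))
    have h2 : Measurable fun p : (π.Seed × W) × (Fin (j + 1) → ℝ) => p.2 (Fin.last j) :=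
      (measurable_pi_apply _).comp measurable_snd
    have h3 : Measurable fun p : (π.Seed × W) × (Fin (j + 1) → ℝ) =>
        h j p.1.2 (p.2 (Fin.last j)) := (hh j).comp (measurable_fst.snd.prodMk h2)
    refine measurable_const.max (measurable_const.min (h1.add ?_))
    exact Measurable.ite (MeasurableSet.const _) measurable_const (h3.sub h2)
  wait_mem j s y := ⟨le_max_left _ _, max_le hM (min_le_left _ _)⟩

variable {Ω : Type*} [MeasurableSpace Ω] {P : Measure Ω} [IsProbabilityMeasure P]
  {Y Y' : ℕ → Ω → ℝ} {g : ℝ≥0 → ℝ≥0} {Q B : ℝ}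

lemma measurable_penalty_age (hQ : 0 ≤ Q) (hg : Continuous g) (hY : ∀ j, Measurable (Y j))
    (π : Policy M) : Measurable fun p : Ω × π.Seed =>
      penalty g (age (fun j => Y j p.1) (π.waits p.2 fun j => Y j p.1) Q) := by
  have h1 : ∀ j, Measurable fun p : Ω × π.Seed => Y j p.1 := fun j => (hY j).comp measurable_fst
  exact (continuous_penalty hg).measurable.comp
    (measurable_age h1 (π.measurable_waits measurable_snd h1) hQ)

lemma expectedPenalty_eq_lintegral (hQ : 0 ≤ Q) (hg : Continuous g) (hY : ∀ j, Measurable (Y j))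
    (π : Policy M) : expectedPenalty P Y g Q π = ∫⁻ s, ∫⁻ ω,
      penalty g (age (fun j => Y j ω) (π.waits s fun j => Y j ω) Q) ∂P ∂π.law :=
  MeasureTheory.lintegral_prod_symm' (μ := P) (ν := π.law) (fun p : Ω × π.Seed =>
    penalty g (age (fun j => Y j p.1) (π.waits p.2 fun j => Y j p.1) Q))
    (measurable_penalty_age hQ hg hY π)

lemma expectedPenalty_simulate_le (hM0 : 0 ≤ M) (hM : Q - B ≤ M) (hQ : 0 ≤ Q)
    (hg : Continuous g) (hgm : Monotone g) (hY : ∀ j, Measurable (Y j))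
    (hY' : ∀ j, Measurable (Y' j)) (π : Policy M) {W : Type} [MeasurableSpace W] (ρ : Measure W)
    [IsProbabilityMeasure ρ] (h : ℕ → W → ℝ → ℝ)
    (hh : ∀ j, Measurable fun p : W × ℝ => h j p.1 p.2)
    (hlaw : (P.prod ρ).map (fun p j => h j p.2 (Y j p.1)) = P.map (fun ω j => Y' j ω))
    (hY0 : ∀ j, ∀ᵐ ω ∂P, 0 ≤ Y j ω)
    (hle : ∀ j, ∀ᵐ p ∂P.prod ρ, Y j p.1 ≤ h j p.2 (Y j p.1))
    (hB : ∀ j, ∀ᵐ ω ∂P, B ≤ Y' j ω) :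
    expectedPenalty P Y g Q (π.simulate hM0 ρ h hh) ≤ expectedPenalty P Y' g Q π := by
  set F : (ℕ → ℝ) × π.Seed → ℝ≥0∞ := fun q => penalty g (age q.1 (π.waits q.2 q.1) Q) with hF
  have hFm : Measurable F := by
    have h1 : ∀ j, Measurable fun q : (ℕ → ℝ) × π.Seed => q.1 j :=
      fun j => (measurable_pi_apply j).comp measurable_fst
    exact (continuous_penalty hg).measurable.comp
      (measurable_age h1 (π.measurable_waits measurable_snd h1) hQ)
  have hT : Measurable fun (p : Ω × W) (j : ℕ) => h j p.2 (Y j p.1) :=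
    measurable_pi_lambda _ fun j => (hh j).comp (measurable_snd.prodMk ((hY j).comp measurable_fst))
  have hT' : Measurable fun (ω : Ω) (j : ℕ) => Y' j ω := measurable_pi_lambda _ hY'
  -- The lower bound passes from `Y'` to the simulated delays through equality of laws.
  have hBh : ∀ j, ∀ᵐ p ∂P.prod ρ, B ≤ h j p.2 (Y j p.1) := by
    intro j
    have hS : MeasurableSet {y : ℕ → ℝ | B ≤ y j} :=
      measurableSet_le measurable_const (measurable_pi_apply j)
    have h1 : ∀ᵐ y ∂P.map (fun ω j => Y' j ω), B ≤ y j := (ae_map_iff hT'.aemeasurable hS).2 (hB j)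
    rw [← hlaw] at h1
    exact (ae_map_iff hT.aemeasurable hS).1 h1
  have hY0' : ∀ j, ∀ᵐ p ∂P.prod ρ, 0 ≤ Y j p.1 :=
    fun j => Measure.quasiMeasurePreserving_fst.ae (hY0 j)
  have hlep : ∀ᵐ q ∂P.prod (π.law.prod ρ), ∀ j, 0 ≤ Y j q.1 ∧ Y j q.1 ≤ h j q.2.2 (Y j q.1) ∧
      B ≤ h j q.2.2 (Y j q.1) := by
    have hmp : Measure.QuasiMeasurePreserving (fun q : Ω × (π.Seed × W) => (q.1, q.2.2))
        (P.prod (π.law.prod ρ)) (P.prod ρ) :=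
      ((MeasurePreserving.id P).prod (measurePreserving_snd)).quasiMeasurePreserving
    exact hmp.ae (ae_all_iff.2 fun j => (hY0' j).and ((hle j).and (hBh j)))
  calc expectedPenalty P Y g Q (π.simulate hM0 ρ h hh)
      ≤ ∫⁻ q : Ω × (π.Seed × W), F (fun j => h j q.2.2 (Y j q.1), q.2.1)
          ∂P.prod (π.law.prod ρ) := by
        refine lintegral_mono_ae ?_
        filter_upwards [hlep] with q hq
        exact monotone_penalty hgm (age_le_age_of_dominated hQ hM (fun j => (hq j).1)
          (fun j => (hq j).2.1) (fun j => (hq j).2.2) (fun j => π.wait_mem _ _ _) fun j => rfl)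
    _ = ∫⁻ s, ∫⁻ ω, F (fun j => Y' j ω, s) ∂P ∂π.law := by
        have := lintegral_prod_prod_eq_lintegral_map P π.law ρ hT hFm
        rw [hlaw] at this
        refine this.trans (lintegral_congr fun s => ?_)
        exact lintegral_map (hFm.comp measurable_prodMk_right) hT'
    _ = expectedPenalty P Y' g Q π := by
        exact (expectedPenalty_eq_lintegral hQ hg hY' π).symm

end Simulation

/-! ### Existence of an optimal policy -/

section Attainment

variable {M : ℝ}

/-- The deterministic policy that observes the delays through `κ` and reads its waiting periods
off the table `c`. -/
noncomputable def tablePolicy (κ : ℝ → ℤ) (hκ : Measurable κ)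
    (c : (Σ j : ℕ, (Fin (j + 1) → ℤ)) → Set.Icc (0 : ℝ) M) : Policy M where
  Seed := Unit
  instMeasurableSpace := inferInstance
  law := Measure.dirac ()
  instIsProbabilityMeasure := inferInstance
  wait j _ y := c ⟨j, fun i => κ (y i)⟩
  measurable_wait j := by
    refine (measurable_of_countable fun k : Fin (j + 1) → ℤ => (c ⟨j, k⟩ : ℝ)).comp ?_
    exact measurable_pi_lambda _ fun i => hκ.comp ((measurable_pi_apply i).comp measurable_snd)
  wait_mem j _ y := (c _).2

variable {Ω : Type*} [MeasurableSpace Ω] {P : Measure Ω} [IsProbabilityMeasure P]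
  {Y : ℕ → Ω → ℝ} {g : ℝ≥0 → ℝ≥0} {Q : ℝ}

/-- For delays that are bounded away from zero and take countably many values, some policy
attains the optimal penalty. -/
lemma exists_expectedPenalty_le_optimalPenalty (hM : 0 ≤ M) (hQ : 0 ≤ Q) (hg : Continuous g)
    (hgm : Monotone g) (hY : ∀ j, Measurable (Y j)) {κ : ℝ → ℤ} (hκ : Measurable κ) {v : ℤ → ℝ}
    (hv : ∀ j ω, v (κ (Y j ω)) = Y j ω) {δ : ℝ} (hδ : 0 < δ) (hYδ : ∀ j, ∀ᵐ ω ∂P, δ ≤ Y j ω) :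
    ∃ π : Policy M, expectedPenalty P Y g Q π ≤ optimalPenalty P Y g Q M := by
  -- A countable product of compact intervals: compact by Tychonoff, and first countable, as Fatou
  -- along `nhds c` requires.
  let C := (Σ j : ℕ, (Fin (j + 1) → ℤ)) → Set.Icc (0 : ℝ) M
  let f : C → Ω → ℝ≥0∞ := fun c ω =>
    penalty g (age (fun j => Y j ω) ((tablePolicy κ hκ c).waits () fun j => Y j ω) Q)
  have hfm : ∀ c, Measurable (f c) := fun c => (continuous_penalty hg).measurable.comp
    (measurable_age hY ((tablePolicy κ hκ c).measurable_waits measurable_const hY) hQ)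
  have hlsc : LowerSemicontinuous fun c => ∫⁻ ω, f c ω ∂P := by
    rw [lowerSemicontinuous_iff_le_liminf]
    intro c
    refine le_trans (lintegral_mono_ae ?_) (lintegral_liminf_le hfm)
    filter_upwards [ae_all_iff.2 hYδ] with ω hω
    suffices h : LowerSemicontinuous fun c => f c ω from lowerSemicontinuous_iff_le_liminf.1 h c
    refine (continuous_penalty hg).comp_lowerSemicontinuous ?_ (monotone_penalty hgm)
    refine lowerSemicontinuous_age hδ hQ hω (fun j => ?_) fun c j => (c _).2.1
    exact continuous_subtype_val.comp (continuous_apply _)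
  have : Nonempty (Set.Icc (0 : ℝ) M) := ⟨⟨0, le_rfl, hM⟩⟩
  obtain ⟨c, -, hc⟩ := LowerSemicontinuousOn.exists_isMinOn (s := (Set.univ : Set C))
    Set.univ_nonempty isCompact_univ (hlsc.lowerSemicontinuousOn _)
  refine ⟨tablePolicy κ hκ c, le_iInf fun π => ?_⟩
  rw [expectedPenalty_eq_lintegral hQ hg hY, expectedPenalty_eq_lintegral hQ hg hY]
  have h1 : ∫⁻ s, ∫⁻ ω, penalty g (age (fun j => Y j ω)
      ((tablePolicy κ hκ c).waits s fun j => Y j ω) Q) ∂P ∂(tablePolicy κ hκ c).law =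
      ∫⁻ ω, f c ω ∂P := by
    change ∫⁻ s : Unit, _ ∂Measure.dirac () = _
    exact lintegral_dirac _ _
  rw [h1]
  calc ∫⁻ ω, f c ω ∂P = ∫⁻ _, ∫⁻ ω, f c ω ∂P ∂π.law := by simp
    _ ≤ _ := by
      refine lintegral_mono fun s => ?_
      -- With its seed frozen, `π` acts as a table, so averaging over seeds cannot beat the best
      -- table.
      let c' : C := fun k => ⟨π.wait k.1 s fun i => v (k.2 i), π.wait_mem _ _ _⟩
      refine (hc (Set.mem_univ c')).trans (le_of_eq (lintegral_congr fun ω => ?_))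
      have : (tablePolicy κ hκ c').waits () (fun j => Y j ω) = π.waits s fun j => Y j ω := by
        funext j
        simp only [Policy.waits, tablePolicy, c', hv]
      simp only [f, this]

end Attainment

/-! ### Resampling delays from their quantization -/

section Resampling

variable {μ : Measure ℝ} [IsProbabilityMeasure μ] {κ : ℝ → ℤ}

open Classical in
/-- The law `μ` conditioned on the fibre of `κ` over `k`, or `μ` itself if that fibre is null. -/
noncomputable def fibreLaw (μ : Measure ℝ) (κ : ℝ → ℤ) (k : ℤ) : Measure ℝ :=
  if μ (κ ⁻¹' {k}) = 0 then μ else μ[|κ ⁻¹' {k}]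

instance (k : ℤ) : IsProbabilityMeasure (fibreLaw μ κ k) := by
  unfold fibreLaw
  split_ifs with h
  · infer_instance
  · exact cond_isProbabilityMeasure h

lemma measure_mul_fibreLaw (hκ : Measurable κ) (k : ℤ) (A : Set ℝ) :
    fibreLaw μ κ k A * μ (κ ⁻¹' {k}) = μ (κ ⁻¹' {k} ∩ A) := by
  unfold fibreLaw
  split_ifs with h
  · rw [h, mul_zero, measure_mono_null Set.inter_subset_left h]
  · exact cond_mul_eq_inter (hκ (measurableSet_singleton k)) A μ

/-- Total probability over the fibres. Letting `A` vary with the fibre covers both the law of a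
resampled delay and its staying in the fibre. -/
lemma lintegral_fibreLaw (hκ : Measurable κ) {A : ℤ → Set ℝ} (hA : ∀ k, MeasurableSet (A k)) :
    ∫⁻ y, fibreLaw μ κ (κ y) (A (κ y)) ∂μ = μ {y | y ∈ A (κ y)} := by
  have h1 : ∫⁻ y, fibreLaw μ κ (κ y) (A (κ y)) ∂μ =
      ∑' k, fibreLaw μ κ k (A k) * μ (κ ⁻¹' {k}) := by
    rw [← lintegral_map (f := fun k => fibreLaw μ κ k (A k)) (measurable_of_countable _) hκ,
      lintegral_countable']
    simp only [Measure.map_apply hκ (measurableSet_singleton _)]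
  have h2 : {y | y ∈ A (κ y)} = ⋃ k, κ ⁻¹' {k} ∩ A k := by
    ext y
    simp
  rw [h1, h2, measure_iUnion]
  · simp only [measure_mul_fibreLaw hκ]
  · intro k l hkl
    refine Set.disjoint_left.2 ?_
    rintro y ⟨rfl, _⟩ ⟨h, _⟩
    exact hkl h
  · exact fun k => (hκ (measurableSet_singleton k)).inter (hA k)

variable {Ω : Type*} [MeasurableSpace Ω] {P : Measure Ω} {Y : ℕ → Ω → ℝ}

lemma measurable_eval_fibre (hκ : Measurable κ) (j : ℕ) :
    Measurable fun p : (ℕ → ℤ → ℝ) × ℝ => p.1 j (κ p.2) := by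
  have : Measurable fun p : ℤ × (ℕ → ℤ → ℝ) => p.2 j p.1 :=
    measurable_from_prod_countable_right fun k =>
      (measurable_pi_apply k).comp (measurable_pi_apply j)
  exact this.comp ((hκ.comp measurable_snd).prodMk measurable_fst)

/-- The law of independent samples, for every index, from all the fibres of `κ`. -/
noncomputable def resampleLaw (μ : Measure ℝ) [IsProbabilityMeasure μ] (κ : ℝ → ℤ) :
    Measure (ℕ → ℤ → ℝ) :=
  Measure.infinitePi fun _ => Measure.infinitePi fun k => fibreLaw μ κ k

instance : IsProbabilityMeasure (resampleLaw μ κ) := by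
  unfold resampleLaw
  infer_instance

lemma resampleLaw_box (s : Finset ℕ) {A : ℕ → Set ℝ} (hA : ∀ j, MeasurableSet (A j)) (k : ℕ → ℤ) :
    resampleLaw μ κ {w | ∀ j ∈ s, w j (k j) ∈ A j} = ∏ j ∈ s, fibreLaw μ κ (k j) (A j) := by
  have h : {w : ℕ → ℤ → ℝ | ∀ j ∈ s, w j (k j) ∈ A j} =
      Set.pi s fun j => (fun v : ℤ → ℝ => v (k j)) ⁻¹' A j := rfl
  have hm : ∀ j, Measurable fun v : ℤ → ℝ => v (k j) := fun j => measurable_pi_apply (k j)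
  rw [h, resampleLaw, Measure.infinitePi_pi _ fun j _ => hm j (hA j)]
  refine Finset.prod_congr rfl fun j _ => ?_
  rw [← Measure.map_apply (hm j) (hA j), Measure.infinitePi_map_eval]

lemma measurable_resample (hκ : Measurable κ) (hY : ∀ j, Measurable (Y j)) (j : ℕ) :
    Measurable fun p : Ω × (ℕ → ℤ → ℝ) => p.2 j (κ (Y j p.1)) :=
  (measurable_eval_fibre hκ j).comp (measurable_snd.prodMk ((hY j).comp measurable_fst))

/-- Given `Y`, the samples are independent over `j`, and the `j`-th conditional probability depends
on `Y j` alone. Independence factors the mass of a box, and total probability makes each factor `μ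
(A j)`. -/
lemma map_resample (hκ : Measurable κ) (hY : ∀ j, Measurable (Y j)) (hindep : iIndepFun Y P)
    (hlaw : ∀ j, P.map (Y j) = μ) :
    (P.prod (resampleLaw μ κ)).map (fun p j => p.2 j (κ (Y j p.1))) =
      P.map (fun ω j => Y j ω) := by
  rw [hindep.map_fun_eq_infinitePi_map hY]
  simp only [hlaw]
  refine Measure.eq_infinitePi _ fun s A hA => ?_
  have hS : MeasurableSet (Set.pi (s : Set ℕ) A) :=
    .pi s.countable_toSet fun j _ => hA j
  have hT := measurable_pi_lambda _ (measurable_resample (Y := Y) hκ hY)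
  rw [Measure.map_apply hT hS, Measure.prod_apply (hT hS)]
  calc ∫⁻ ω, resampleLaw μ κ {w | ∀ j ∈ s, w j (κ (Y j ω)) ∈ A j} ∂P
      = ∫⁻ ω, ∏ j ∈ s, fibreLaw μ κ (κ (Y j ω)) (A j) ∂P :=
        lintegral_congr fun ω => resampleLaw_box s hA fun j => κ (Y j ω)
    _ = ∏ j ∈ s, ∫⁻ ω, fibreLaw μ κ (κ (Y j ω)) (A j) ∂P := by
        have hm : ∀ j, Measurable fun y => fibreLaw μ κ (κ y) (A j) := fun j =>
          (measurable_of_countable fun k => fibreLaw μ κ k (A j)).comp hκ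
        exact lintegral_prod_eq_prod_lintegral_of_indepFun s
          (fun j ω => fibreLaw μ κ (κ (Y j ω)) (A j))
          (hindep.comp (fun j y => fibreLaw μ κ (κ y) (A j)) hm) fun j => (hm j).comp (hY j)
    _ = ∏ j ∈ s, μ (A j) := by
        refine Finset.prod_congr rfl fun j _ => ?_
        have hm : Measurable fun y => fibreLaw μ κ (κ y) (A j) :=
          (measurable_of_countable fun k => fibreLaw μ κ k (A j)).comp hκ
        rw [← lintegral_map hm (hY j), hlaw, lintegral_fibreLaw hκ fun _ => hA j]
        rfl

lemma ae_resample_mem_fibre (hκ : Measurable κ) (hY : ∀ j, Measurable (Y j))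
    (hlaw : ∀ j, P.map (Y j) = μ) (j : ℕ) :
    ∀ᵐ p ∂P.prod (resampleLaw μ κ), κ (p.2 j (κ (Y j p.1))) = κ (Y j p.1) := by
  have hS : MeasurableSet {p : Ω × (ℕ → ℤ → ℝ) | κ (p.2 j (κ (Y j p.1))) = κ (Y j p.1)}ᶜ :=
    (measurableSet_eq_fun (hκ.comp (measurable_resample hκ hY j))
      (hκ.comp ((hY j).comp measurable_fst))).compl
  have hA : ∀ k, MeasurableSet (κ ⁻¹' {k})ᶜ := fun k => (hκ (measurableSet_singleton k)).compl
  rw [ae_iff]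
  change P.prod (resampleLaw μ κ)
    {p : Ω × (ℕ → ℤ → ℝ) | κ (p.2 j (κ (Y j p.1))) = κ (Y j p.1)}ᶜ = 0
  rw [Measure.prod_apply hS]
  have hm : Measurable fun y => fibreLaw μ κ (κ y) (κ ⁻¹' {κ y})ᶜ :=
    (measurable_of_countable fun k => fibreLaw μ κ k (κ ⁻¹' {k})ᶜ).comp hκ
  calc ∫⁻ ω, resampleLaw μ κ {w | ¬ κ (w j (κ (Y j ω))) = κ (Y j ω)} ∂P
      = ∫⁻ ω, fibreLaw μ κ (κ (Y j ω)) (κ ⁻¹' {κ (Y j ω)})ᶜ ∂P := by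
        refine lintegral_congr fun ω => ?_
        have := resampleLaw_box (μ := μ) (κ := κ) {j} (fun _ => hA (κ (Y j ω)))
          fun j => κ (Y j ω)
        simpa using this
    _ = 0 := by
        rw [← lintegral_map hm (hY j), hlaw, lintegral_fibreLaw hκ hA]
        simp

end Resampling

end PullOrWait

theorem proposition7 {Ω : Type*} [MeasurableSpace Ω] (P : Measure Ω) [IsProbabilityMeasure P]
    (Y : ℕ → Ω → ℝ) (B_L B_U : ℝ) (hBL : 0 < B_L)
    (hmeas : ∀ j, Measurable (Y j))
    (hindep : iIndepFun Y P)
    (hident : ∀ j, IdentDistrib (Y j) (Y 0) P P)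
    (hbound : ∀ j, ∀ᵐ ω ∂P, Y j ω ∈ Set.Icc B_L B_U)
    (g : ℝ≥0 → ℝ≥0) (hg_cont : Continuous g) (hg_mono : Monotone g)
    (Q : ℝ) (hQ : 0 < Q)
    (M : ℝ) (hM_nonneg : 0 ≤ M) (hM : Q - B_L ≤ M)
    (N : ℕ) (hN : 0 < N) :
    (∃ π : PullOrWait.Policy M,
      PullOrWait.expectedPenalty P Y g Q π ≤
        PullOrWait.optimalPenalty P (PullOrWait.upperQuantized (Q / N) Y) g Q M) ∧
    PullOrWait.optimalPenalty P (PullOrWait.lowerQuantized (Q / N) Y) g Q M ≤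
      PullOrWait.optimalPenalty P Y g Q M := by
  have hq : 0 < Q / N := div_pos hQ (Nat.cast_pos.2 hN)
  set q := Q / N
  have hceil : Measurable fun y : ℝ => ⌈y / q⌉ := (measurable_id.div_const q).ceil
  have hfloor : Measurable fun y : ℝ => ⌊y / q⌋ := (measurable_id.div_const q).floor
  have hup : Measurable fun y : ℝ => q * (⌈y / q⌉ : ℝ) :=
    (measurable_of_countable fun k : ℤ => q * (k : ℝ)).comp hceil
  have hlow : Measurable fun y : ℝ => q * (⌊y / q⌋ : ℝ) :=
    (measurable_of_countable fun k : ℤ => q * (k : ℝ)).comp hfloor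
  have hle_up : ∀ y, y ≤ q * (⌈y / q⌉ : ℝ) := fun y => (div_le_iff₀' hq).1 (Int.le_ceil _)
  have hlow_le : ∀ y, q * (⌊y / q⌋ : ℝ) ≤ y := fun y => (le_div_iff₀' hq).1 (Int.floor_le _)
  have hup_meas : ∀ j, Measurable (PullOrWait.upperQuantized q Y j) := fun j => hup.comp (hmeas j)
  have hlow_meas : ∀ j, Measurable (PullOrWait.lowerQuantized q Y j) :=
    fun j => hlow.comp (hmeas j)
  have hup_bound : ∀ j, ∀ᵐ ω ∂P, B_L ≤ PullOrWait.upperQuantized q Y j ω := fun j =>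
    (hbound j).mono fun ω hω => hω.1.trans (hle_up _)
  constructor
  · obtain ⟨π, hπ⟩ := PullOrWait.exists_expectedPenalty_le_optimalPenalty (P := P) (g := g)
      (v := fun k => q * (k : ℝ)) hM_nonneg hQ.le hg_cont hg_mono hup_meas hceil
      (fun j ω => by simp [PullOrWait.upperQuantized, hq.ne']) hBL hup_bound
    refine ⟨π.simulate hM_nonneg (Measure.dirac ()) (fun _ _ y => q * (⌈y / q⌉ : ℝ))
      fun _ => hup.comp measurable_snd, le_trans ?_ hπ⟩
    refine PullOrWait.expectedPenalty_simulate_le hM_nonneg hM hQ.le hg_cont hg_mono hmeas hup_meas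
      π _ _ _ ?_ (fun j => (hbound j).mono fun ω hω => hBL.le.trans hω.1)
      (fun j => .of_forall fun p => hle_up _) hup_bound
    -- Rounding up needs no extra randomness, so the additional seed is trivial.
    have h := (measurePreserving_fst (μ := P) (ν := Measure.dirac ())).map_eq
    nth_rw 2 [← h]
    rw [Measure.map_map (measurable_pi_lambda _ hup_meas) measurable_fst]
    rfl
  · refine le_iInf fun π => ?_
    have : IsProbabilityMeasure (P.map (Y 0)) :=
      Measure.isProbabilityMeasure_map (hmeas 0).aemeasurable
    have hlaw : ∀ j, P.map (Y j) = P.map (Y 0) := fun j => (hident j).map_eq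
    -- The fibre index is recoverable from the quantized delay, the only delay that the simulating
    -- policy observes.
    have hback : ∀ j ω, ⌊PullOrWait.lowerQuantized q Y j ω / q⌋ = ⌊Y j ω / q⌋ := fun j ω => by
      simp [PullOrWait.lowerQuantized, hq.ne']
    refine (iInf_le _ (π.simulate hM_nonneg
      (PullOrWait.resampleLaw (P.map (Y 0)) fun y => ⌊y / q⌋)
      (fun j w y => w j ⌊y / q⌋) (PullOrWait.measurable_eval_fibre hfloor))).trans ?_
    refine PullOrWait.expectedPenalty_simulate_le hM_nonneg hM hQ.le hg_cont hg_mono hlow_meas hmeas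
      π _ _ _ ?_ (fun j => ?_) (fun j => ?_) fun j => (hbound j).mono fun ω hω => hω.1
    · simp only [hback]
      exact PullOrWait.map_resample hfloor hmeas hindep hlaw
    · filter_upwards [hbound j] with ω hω
      exact mul_nonneg hq.le (Int.cast_nonneg (Int.floor_nonneg.2
        (div_nonneg (hBL.le.trans hω.1) hq.le)))
    · filter_upwards [PullOrWait.ae_resample_mem_fibre hfloor hmeas hlaw j] with p hp
      rw [hback]
      calc PullOrWait.lowerQuantized q Y j p.1 = q * (⌊p.2 j ⌊Y j p.1 / q⌋ / q⌋ : ℝ) := by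
            rw [hp]; rfl
        _ ≤ _ := hlow_le _
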